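/- Let $V$ be a finite set and let $\mathcal Y_V=(Y_v(t))_{v\in V,\,t\in\mathbb R}$ be a real- or complex-valued, square-integrable stochastic process on a probability space such that $\mathbb E[Y_v(t)]=0$ for all $v,t$; it is wide-sense stationary, i.e. $\mathbb E[Y_a(s+t)\overline{Y_b(s)}]$ does not depend on $s$; and it is mean-square continuous. Write $c_{ab}(t)=\mathbb E[Y_a(t)\overline{Y_b(0)}]$. Suppose that $\mathcal Y_V$ has a spectral density function $f:\mathbb R\to\mathbb C^{V\times V}$, i.e. the entries of $f$ are integrable and $$c_{ab}(t)=\int_{-\infty}^{\infty}e^{i\lambda t}f_{ab}(\lambda)\,d\lambda\qquad (a,b\in V,\ t\in\mathbb R),$$ and that the matrix $f(\lambda)$ is (Hermitian) positive definite for every $\lambda\in\mathbb R$. For $C\subseteq V$ let $\mathcal L_{C}\subseteq L^2(\mathbb P;\mathbb C)$ be the closed complex linear span of $\{Y_c(t): c\in C,\ t\in\mathbb R\}$, let $P_{\mathcal L_C}$ be the orthogonal projection of $L^2(\mathbb P;\mathbb C)$ onto $\mathcal L_C$, and let $\varepsilon_{a|C}(t)=Y_a(t)-P_{\mathcal L_C}Y_a(t)$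 be the noise process. For $A,B,C\subseteq V$ say that $\mathcal Y_A$ and $\mathcal Y_B$ are partially uncorrelated given $\mathcal Y_C$, written $\mathcal Y_A\perp\!\!\!\perp\mathcal Y_B\mid\mathcal Y_C$, if the cross-covariance function of their noise processes given $\mathcal Y_C$ vanishes identically: $$\mathbb E\big[\varepsilon_{a|C}(s)\,\overline{\varepsilon_{b|C}(t)}\big]=0\qquad\text{for all } a\in A,\ b\in B,\ s,t\in\mathbb R.$$ Then the partial correlation relation is a graphoid: for all pairwise disjoint (possibly empty) sets $A,B,C,D\subseteq V$ the following hold. 1. Symmetry: $\mathcal Y_A\perp\!\!\!\perp\mathcal Y_B\mid\mathcal Y_C$ implies $\mathcal Y_B\perp\!\!\!\perp\mathcal Y_A\mid\mathcal Y_C$. 2. Decomposition: $\mathcal Y_A\perp\!\!\!\perp\mathcal Y_{B\cup C}\mid\mathcal Y_D$ implies $\mathcal Y_A\perp\!\!\!\perp\mathcal Y_B\mid\mathcal Y_D$. 3. Weak union: $\mathcal Y_A\perp\!\!\!\perp\mathcal Y_{B\cup C}\mid\mathcal Y_D$ implies $\mathcal Y_A\perp\!\!\!\perp\mathcal Y_B\mid\mathcal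 Y_{C\cup D}$. 4. Contraction: $\mathcal Y_A\perp\!\!\!\perp\mathcal Y_B\mid\mathcal Y_D$ and $\mathcal Y_A\perp\!\!\!\perp\mathcal Y_C\mid\mathcal Y_{B\cup D}$ imply $\mathcal Y_A\perp\!\!\!\perp\mathcal Y_{B\cup C}\mid\mathcal Y_D$. 5. Intersection: $\mathcal Y_A\perp\!\!\!\perp\mathcal Y_B\mid\mathcal Y_{C\cup D}$ and $\mathcal Y_A\perp\!\!\!\perp\mathcal Y_C\mid\mathcal Y_{B\cup D}$ imply $\mathcal Y_A\perp\!\!\!\perp\mathcal Y_{B\cup C}\mid\mathcal Y_D$. -/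

import Mathlib

open MeasureTheory Filter Topology
open scoped ComplexConjugate ComplexOrder

noncomputable section

/-- A square-integrable (real- or complex-valued) continuous-time stochastic process
`(Y_v(t))_{t ∈ ℝ}`, `v ∈ V`, which has expectation zero, is wide-sense stationary and is
mean-square continuous. -/
structure StationaryProcess (V : Type*) {Ω : Type*} [MeasurableSpace Ω] (P : Measure Ω) where
  /-- the value `Y_v(t)`, a random variable -/
  Y : V → ℝ → Ω → ℂ
  memLp : ∀ a t, MemLp (Y a t) 2 P
  mean_zero : ∀ a t, ∫ ω, Y a t ω ∂P = 0
  /-- `E[Y_a(s + t) conj Y_b(s)]` does not depend on `s`. -/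
  stationary : ∀ a b s t,
    ∫ ω, Y a (s + t) ω * conj (Y b s ω) ∂P = ∫ ω, Y a t ω * conj (Y b 0 ω) ∂P
  ms_continuous : ∀ a t,
    Tendsto (fun s => ∫ ω, ‖Y a s ω - Y a t ω‖ ^ 2 ∂P) (𝓝 t) (𝓝 0)

namespace StationaryProcess

variable {V Ω : Type*} [MeasurableSpace Ω] {P : Measure Ω}

/-- The autocovariance function, `c_{ab}(t) = E[Y_a(t) conj Y_b(0)]`. -/
def autocov (X : StationaryProcess V P) (a b : V) (t : ℝ) : ℂ :=
  ∫ ω, X.Y a t ω * conj (X.Y b 0 ω) ∂P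

/-- `f` is a spectral density function of the process: it is integrable and
`c_{ab}(t) = ∫ e^{i l t} f_{ab}(l) dl` for all `t`. -/
structure IsSpectralDensity (X : StationaryProcess V P) (f : ℝ → Matrix V V ℂ) : Prop where
  integrable : ∀ a b, Integrable (fun l : ℝ => f l a b)
  autocov_eq : ∀ a b t,
    X.autocov a b t = ∫ l : ℝ, Complex.exp (Complex.I * (l : ℂ) * (t : ℂ)) * f l a b

/-- The random variable `Y_a(t)` as an element of the Hilbert space `L²(P)`. -/
def toL2 (X : StationaryProcess V P) (a : V) (t : ℝ) : Lp ℂ 2 P :=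
  (X.memLp a t).toLp (X.Y a t)

/-- The closed linear space generated by the subprocess indexed by `C` over all time points:
the mean-square closure of the complex linear span of `Y_c(t)`, `c ∈ C`, `t ∈ ℝ`. -/
def linSpace (X : StationaryProcess V P) (C : Set V) : Submodule ℂ (Lp ℂ 2 P) :=
  (Submodule.span ℂ {y | ∃ c ∈ C, ∃ t : ℝ, y = X.toL2 c t}).topologicalClosure

instance (X : StationaryProcess V P) (C : Set V) : CompleteSpace (X.linSpace C) :=
  (Submodule.isClosed_topologicalClosure _).completeSpace_coe

/-- The noise process: `Y_a(t)` minus its orthogonal projection on `X.linSpace C`. -/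
def noise (X : StationaryProcess V P) (C : Set V) (a : V) (t : ℝ) : Lp ℂ 2 P :=
  X.toL2 a t - (X.linSpace C).starProjection (X.toL2 a t)

/-- The subprocesses indexed by `A` and `B` are partially uncorrelated given the subprocess
indexed by `C`: the noise processes of `A` and of `B` are uncorrelated processes, that is,
their cross-covariance vanishes at every pair of time points (equivalently, by stationarity,
at every lag). -/
def PartiallyUncorrelated (X : StationaryProcess V P) (A B C : Set V) : Prop :=
  ∀ a ∈ A, ∀ b ∈ B, ∀ s t : ℝ, ∫ ω, X.noise C a s ω * conj (X.noise C b t ω) ∂P = 0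

end StationaryProcess

end

/-!
With `L_C` the closed linear span of the subprocess indexed by `C`, the subprocesses `A` and `B`
are partially uncorrelated given `C` exactly when, for every `a ∈ A` and every `s`, the projection
of `Y_a(s)` on `L_{B ∪ C}` already lies in `L_C` (`partiallyUncorrelated_iff`). Symmetry,
decomposition, weak union and contraction follow from this by Hilbert space geometry alone.
Intersection reduces to `L_{C ∪ D} ∩ L_{B ∪ D} = L_D`, an instance of
`L_S ∩ L_T = L_{S ∩ T}` (`IsSpectralDensity.linSpace_inf`), and only here is the positive
definite spectral density needed.

Put `F = fᵀ`. To `y ∈ L_S` one attaches the cross-spectral densities `g_w ∈ L¹(ℝ)` for which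
`⟪Y_w(s), y⟫ = ∫ e^{-ils} g_w(l) dl`. If `y` is a finite linear combination of the process, then
`g = F φ`, where `φ` is a vector of trigonometric polynomials supported in `S`, and
`‖y‖² = ∫ φ* F φ`. The Cauchy–Schwarz inequality for `F(l)` bounds `‖g‖₁` by a multiple of `‖y‖`,
so `g` exists for all `y ∈ L_S`; since `F(l)` maps the vectors supported in `S` onto a closed
subspace of `ℂ^V`, still `g(l) = F(l) φ(l)` for almost every `l` with `φ(l)` supported in `S`
(`IsSpectralDensity.exists_crossSpec_of_mem_linSpace`). Only pointwise existence of `φ` is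
claimed, so no spectral isomorphism with a weighted `L²` space is required.

Now let `y ∈ L_S ∩ L_T` be orthogonal to `L_{S ∩ T}`. An `L¹` function is determined by its Fourier
transform, so `g` is the same for `S` and for `T`, and, as `F(l)` is invertible, so is `φ`; hence
`φ` is supported in `S ∩ T`. Orthogonality says that `g_w = 0` almost everywhere for `w ∈ S ∩ T`.
Therefore `φ* F φ = φ* g = 0`, which gives `φ = 0` and `g = 0`, so that `y` is orthogonal to `L_S`,
and `y = 0`.
-/

/-! ### Fourier uniqueness for integrable functions -/

namespace MeasureTheory

open scoped FourierTransform in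
/-- An integrable function with vanishing Fourier transform is zero almost everywhere: every test
function is the Fourier transform of a Schwartz function, and the Fourier transform can be moved
from that function to `g`. -/
theorem Integrable.ae_eq_zero_of_integral_conj_exp_mul_eq_zero {g : ℝ → ℂ} (hg : Integrable g)
    (h : ∀ t : ℝ, ∫ l : ℝ, conj (Complex.exp (Complex.I * l * t)) * g l = 0) :
    ∀ᵐ l, g l = 0 := by
  have hF : 𝓕 g = 0 := by
    ext w
    rw [Real.fourier_real_eq_integral_exp_smul, Pi.zero_apply, ← h (2 * Real.pi * w)]
    refine integral_congr_ae (Eventually.of_forall fun l => ?_)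
    simp only [smul_eq_mul, ← Complex.exp_conj, map_mul, Complex.conj_I, Complex.conj_ofReal]
    congr 2
    push_cast
    ring
  refine ae_eq_zero_of_integral_contDiff_smul_eq_zero hg.locallyIntegrable fun φ hφ hφc => ?_
  have hc : HasCompactSupport (Complex.ofRealCLM ∘ φ) := hφc.comp_left rfl
  have hs : ContDiff ℝ (⊤ : ℕ∞) (Complex.ofRealCLM ∘ φ) := by fun_prop
  set ψ : SchwartzMap ℝ ℂ := hc.toSchwartzMap hs
  set χ : SchwartzMap ℝ ℂ := 𝓕⁻ ψ
  have key := VectorFourier.integral_fourierIntegral_smul_eq_flip (L := innerₗ ℝ)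
    (μ := volume) (ν := volume) Real.continuous_fourierChar continuous_inner
    χ.integrable hg
  have hflip : (innerₗ ℝ).flip = innerₗ ℝ := by
    ext
    simp
  have h1 : ∀ x, VectorFourier.fourierIntegral Real.fourierChar volume (innerₗ ℝ) χ x
      = ψ x := fun x => by
    have h2 : 𝓕 χ = ψ := FourierTransform.fourier_fourierInv_eq ψ
    calc _ = 𝓕 (⇑χ) x := rfl
      _ = (𝓕 χ) x := by rw [SchwartzMap.fourier_coe]
      _ = ψ x := by rw [h2]
  have h3 : ∀ x, VectorFourier.fourierIntegral Real.fourierChar volume (innerₗ ℝ) g x = 0 :=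
    fun x => congrFun hF x
  simp only [hflip, h1, h3, smul_zero, integral_zero] at key
  rw [← key]
  rfl

theorem Integrable.conj_exp_mul {g : ℝ → ℂ} (hg : Integrable g) (t : ℝ) :
    Integrable fun l : ℝ => conj (Complex.exp (Complex.I * l * t)) * g l := by
  refine hg.bdd_mul (c := 1) (Continuous.aestronglyMeasurable (by fun_prop))
    (Eventually.of_forall fun l => ?_)
  rw [RCLike.norm_conj, mul_assoc, ← Complex.ofReal_mul, Complex.norm_exp_I_mul_ofReal]

end MeasureTheory

/-! ### An inequality for positive semidefinite matrices -/

namespace Matrix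

/-- The Cauchy–Schwarz inequality `|e_i* M x|² ≤ (e_i* M e_i) (x* M x)`, in the form given by the
inequality of arithmetic and geometric means with weight `c`. -/
theorem PosSemidef.two_mul_norm_mulVec_le {n : Type*} [Fintype n] {M : Matrix n n ℂ}
    (hM : M.PosSemidef) (x : n → ℂ) (i : n) {c : ℝ} (hc : 0 < c) :
    2 * ‖(M *ᵥ x) i‖ ≤ c * (M i i).re + c⁻¹ * (star x ⬝ᵥ (M *ᵥ x)).re := by
  classical
  set z : ℂ := (M *ᵥ x) i with hz
  obtain ⟨u, hu, huz⟩ : ∃ u : ℂ, ‖u‖ = 1 ∧ conj u * z = ‖z‖ := by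
    by_cases h0 : z = 0
    · exact ⟨1, by simp, by simp [h0]⟩
    · have hn : (‖z‖ : ℂ) ≠ 0 := by simpa using h0
      refine ⟨z / ‖z‖, by simp [h0], ?_⟩
      rw [map_div₀, Complex.conj_ofReal, div_mul_eq_mul_div, Complex.conj_mul', sq,
        mul_div_cancel_right₀ _ hn]
  -- Positivity of `M` is applied to `c u e_i - x`, where the phase `u` makes the cross term real.
  set e : n → ℂ := Pi.single i (c * u) with he
  have h := (Complex.le_def.1 (hM.dotProduct_mulVec_nonneg (e - x))).1
  have hse : star e = Pi.single i (c * conj u) := by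
    rw [he, ← Pi.single_star]
    simp
  have hMe : (M *ᵥ e) i = c * u * M i i := by
    rw [he, mulVec_single]
    simp [mul_comm]
  have h1 : star e ⬝ᵥ (M *ᵥ e) = c ^ 2 * M i i := by
    have : conj u * u = 1 := by rw [Complex.conj_mul', hu]; simp
    rw [hse, single_dotProduct, hMe]
    linear_combination (c : ℂ) ^ 2 * M i i * this
  have h2 : star e ⬝ᵥ (M *ᵥ x) = c * ‖z‖ := by
    rw [hse, single_dotProduct, ← hz, mul_assoc, huz]
  have h3 : star x ⬝ᵥ (M *ᵥ e) = star (star e ⬝ᵥ (M *ᵥ x)) := by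
    rw [← star_dotProduct_star, star_star, star_mulVec, hM.isHermitian.eq, dotProduct_mulVec]
  have h4 : star (e - x) ⬝ᵥ (M *ᵥ (e - x))
      = c ^ 2 * M i i - 2 * (c * ‖z‖) + star x ⬝ᵥ (M *ᵥ x) := by
    rw [mulVec_sub, star_sub, sub_dotProduct, dotProduct_sub, dotProduct_sub, h3, h1, h2]
    simp only [star_mul', Complex.star_def, Complex.conj_ofReal]
    ring
  rw [h4] at h
  have h5 : 0 ≤ c ^ 2 * (M i i).re - 2 * (c * ‖z‖) + (star x ⬝ᵥ (M *ᵥ x)).re := by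
    simpa [← Complex.ofReal_pow, ← Complex.ofReal_mul] using h
  have h6 : c * (M i i).re + c⁻¹ * (star x ⬝ᵥ (M *ᵥ x)).re - 2 * ‖z‖
      = c⁻¹ * (c ^ 2 * (M i i).re - 2 * (c * ‖z‖) + (star x ⬝ᵥ (M *ᵥ x)).re) := by
    field_simp
    ring
  have h7 := mul_nonneg (inv_nonneg.2 hc.le) h5
  linarith

end Matrix

/-! ### Partial uncorrelatedness through projections -/

namespace StationaryProcess

variable {V Ω : Type*} [MeasurableSpace Ω] {P : Measure Ω}

theorem toL2_mem_linSpace (X : StationaryProcess V P) {C : Set V} {c : V} (hc : c ∈ C) (t : ℝ) :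
    X.toL2 c t ∈ X.linSpace C :=
  Submodule.le_topologicalClosure _ (Submodule.subset_span ⟨c, hc, t, rfl⟩)

theorem linSpace_mono (X : StationaryProcess V P) {C D : Set V} (h : C ⊆ D) :
    X.linSpace C ≤ X.linSpace D :=
  Submodule.topologicalClosure_mono <| Submodule.span_mono fun _ ⟨c, hc, t, ht⟩ => ⟨c, h hc, t, ht⟩

theorem mem_orthogonal_linSpace (X : StationaryProcess V P) {C : Set V} {y : Lp ℂ 2 P}
    (h : ∀ c ∈ C, ∀ t, inner ℂ (X.toL2 c t) y = 0) : y ∈ (X.linSpace C)ᗮ := by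
  rw [linSpace, Submodule.orthogonal_closure, Submodule.mem_orthogonal]
  intro u hu
  induction hu using Submodule.span_induction with
  | mem x hx => obtain ⟨c, hc, t, rfl⟩ := hx; exact h c hc t
  | zero => simp
  | add x y _ _ hx hy => rw [inner_add_left, hx, hy, add_zero]
  | smul a x _ hx => rw [inner_smul_left, hx, mul_zero]

theorem partiallyUncorrelated_iff_inner (X : StationaryProcess V P) (A B C : Set V) :
    X.PartiallyUncorrelated A B C ↔
      ∀ a ∈ A, ∀ b ∈ B, ∀ s t, inner ℂ (X.noise C b t) (X.noise C a s) = 0 := by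
  simp only [PartiallyUncorrelated, L2.inner_def, RCLike.inner_apply]

theorem partiallyUncorrelated_symm (X : StationaryProcess V P) {A B C : Set V}
    (h : X.PartiallyUncorrelated A B C) : X.PartiallyUncorrelated B A C := by
  rw [partiallyUncorrelated_iff_inner] at h ⊢
  exact fun b hb a ha t s => inner_eq_zero_symm.1 (h a ha b hb s t)

/-- Projecting `Y_a(s)` on the larger space `L_{B ∪ C}` gives nothing beyond `L_C`. -/
theorem partiallyUncorrelated_iff (X : StationaryProcess V P) (A B C : Set V) :
    X.PartiallyUncorrelated A B C ↔
      ∀ a ∈ A, ∀ s, (X.linSpace (B ∪ C)).starProjection (X.toL2 a s) ∈ X.linSpace C := by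
  have hn : ∀ a s, X.noise C a s ∈ (X.linSpace C)ᗮ := fun a s =>
    Submodule.sub_starProjection_mem_orthogonal _
  have hinner : ∀ a b s t, inner ℂ (X.noise C b t) (X.noise C a s)
      = inner ℂ (X.toL2 b t) (X.noise C a s) := fun a b s t => by
    conv_lhs => rw [noise, inner_sub_left,
      hn a s _ (Submodule.starProjection_apply_mem _ _), sub_zero]
  rw [partiallyUncorrelated_iff_inner]
  simp only [hinner]
  constructor
  · intro h a ha s
    have : X.noise C a s ∈ (X.linSpace (B ∪ C))ᗮ := by
      refine X.mem_orthogonal_linSpace fun c hc t => ?_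
      rcases hc with hc | hc
      · exact h a ha c hc s t
      · exact hn a s _ (X.toL2_mem_linSpace hc t)
    rw [Submodule.eq_starProjection_of_mem_orthogonal
      (X.linSpace_mono Set.subset_union_right (Submodule.starProjection_apply_mem _ _)) this]
    exact Submodule.starProjection_apply_mem _ _
  · intro h a ha b hb s t
    have hC : (X.linSpace C).starProjection (X.toL2 a s)
        = (X.linSpace (B ∪ C)).starProjection (X.toL2 a s) :=
      Submodule.eq_starProjection_of_mem_orthogonal (h a ha s)
        (Submodule.orthogonal_le (X.linSpace_mono Set.subset_union_right)
          (Submodule.sub_starProjection_mem_orthogonal _))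
    rw [noise, hC]
    exact Submodule.sub_starProjection_mem_orthogonal _ _
      (X.toL2_mem_linSpace (Set.mem_union_left _ hb) t)

/-! ### Cross-spectral densities of finite linear combinations -/

theorem IsSpectralDensity.inner_toL2 {X : StationaryProcess V P} {f : ℝ → Matrix V V ℂ}
    (hf : X.IsSpectralDensity f) (a b : V) (s t : ℝ) :
    inner ℂ (X.toL2 b s) (X.toL2 a t)
      = ∫ l : ℝ, conj (Complex.exp (Complex.I * l * s)) *
          (Complex.exp (Complex.I * l * t) * f l a b) := by
  have h1 : inner ℂ (X.toL2 b s) (X.toL2 a t) = X.autocov a b (t - s) := by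
    rw [autocov, ← X.stationary a b s (t - s), L2.inner_def, add_sub_cancel]
    refine integral_congr_ae ?_
    filter_upwards [(X.memLp b s).coeFn_toLp, (X.memLp a t).coeFn_toLp] with ω hb ha
    rw [toL2, toL2, ha, hb, RCLike.inner_apply]
  rw [h1, hf.autocov_eq]
  refine integral_congr_ae (Eventually.of_forall fun l => ?_)
  simp only [← mul_assoc, ← Complex.exp_conj, ← Complex.exp_add, map_mul, Complex.conj_I,
    Complex.conj_ofReal]
  congr 2
  push_cast
  ring

/-- The finite linear combination `∑ c_{(v,t)} Y_v(t)` of the random variables of the process,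
with coefficients the finitely supported function `c` on `V × ℝ`. -/
noncomputable def comb (X : StationaryProcess V P) : (V × ℝ →₀ ℂ) →ₗ[ℂ] Lp ℂ 2 P :=
  Finsupp.linearCombination ℂ fun p => X.toL2 p.1 p.2

/-- The value at frequency `l` of the vector of trigonometric polynomials attached to a finite
linear combination of the `Y_v(t)`: its `v`-th component is `∑_t c_{(v,t)} e^{ilt}`. -/
noncomputable def trigVec [DecidableEq V] (l : ℝ) : (V × ℝ →₀ ℂ) →ₗ[ℂ] V → ℂ :=
  Finsupp.linearCombination ℂ fun p => Pi.single p.1 (Complex.exp (Complex.I * l * p.2))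

/-- The vector of cross-spectral densities, at frequency `l`, between a finite linear combination
of the `Y_v(t)` and the components of the process. The transpose appears because `f` is the
spectral density of `E[Y_a(t) conj Y_b(0)]`, whereas the inner product of `L²` is conjugate-linear
in its first argument. -/
noncomputable def crossSpec [Fintype V] [DecidableEq V] (f : ℝ → Matrix V V ℂ) (l : ℝ) :
    (V × ℝ →₀ ℂ) →ₗ[ℂ] V → ℂ :=
  (f l).transpose.mulVecLin ∘ₗ trigVec l

theorem trigVec_single [DecidableEq V] (l : ℝ) (v : V) (t : ℝ) (c : ℂ) :
    trigVec l (Finsupp.single (v, t) c) = Pi.single v (c * Complex.exp (Complex.I * l * t)) := by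
  rw [trigVec, Finsupp.linearCombination_single, ← Pi.single_smul, smul_eq_mul]

theorem star_trigVec_single_dotProduct [Fintype V] [DecidableEq V] (l : ℝ) (v : V) (t : ℝ) (c : ℂ)
    (g : V → ℂ) :
    dotProduct (star (trigVec l (Finsupp.single (v, t) c))) g
      = conj c * (conj (Complex.exp (Complex.I * l * t)) * g v) := by
  rw [trigVec_single, ← Pi.single_star, single_dotProduct, star_mul', mul_assoc]
  rfl

theorem trigVec_apply_eq_zero [DecidableEq V] {S : Set V} {c : V × ℝ →₀ ℂ}
    (hc : c ∈ Finsupp.supported ℂ ℂ (Prod.fst ⁻¹' S : Set (V × ℝ))) {v : V} (hv : v ∉ S) (l : ℝ) :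
    trigVec l c v = 0 := by
  rw [trigVec, Finsupp.linearCombination_apply, Finsupp.sum, Finset.sum_apply]
  refine Finset.sum_eq_zero fun p hp => ?_
  have : v ≠ p.1 := fun h => hv (h ▸ hc hp)
  simp [Pi.single_eq_of_ne this]

theorem exists_seq_comb_tendsto (X : StationaryProcess V P) {S : Set V} {y : Lp ℂ 2 P}
    (hy : y ∈ X.linSpace S) :
    ∃ c : ℕ → V × ℝ →₀ ℂ,
      (∀ n, c n ∈ Finsupp.supported ℂ ℂ (Prod.fst ⁻¹' S : Set (V × ℝ))) ∧
      Tendsto (fun n => X.comb (c n)) atTop (𝓝 y) := by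
  obtain ⟨u, hu, huy⟩ := mem_closure_iff_seq_limit.1 hy
  have himage : {y | ∃ c ∈ S, ∃ t : ℝ, y = X.toL2 c t}
      = (fun p : V × ℝ => X.toL2 p.1 p.2) '' (Prod.fst ⁻¹' S) := by
    ext y
    constructor
    · rintro ⟨c, hc, t, rfl⟩
      exact ⟨(c, t), hc, rfl⟩
    · rintro ⟨p, hp, rfl⟩
      exact ⟨p.1, hp, p.2, rfl⟩
  rw [himage] at hu
  choose c hc hcu using fun n => (Finsupp.mem_span_image_iff_linearCombination ℂ).1 (hu n)
  refine ⟨c, hc, ?_⟩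
  simpa only [comb, hcu] using huy

variable [Fintype V] [DecidableEq V]

theorem crossSpec_apply (f : ℝ → Matrix V V ℂ) (l : ℝ) (c : V × ℝ →₀ ℂ) :
    crossSpec f l c = (f l).transpose.mulVec (trigVec l c) := rfl

theorem crossSpec_single (f : ℝ → Matrix V V ℂ) (l : ℝ) (v w : V) (t : ℝ) (c : ℂ) :
    crossSpec f l (Finsupp.single (v, t) c) w
      = c * (Complex.exp (Complex.I * l * t) * f l v w) := by
  rw [crossSpec_apply, trigVec_single, Matrix.mulVec_single]
  simp [mul_comm, mul_left_comm]

variable {X : StationaryProcess V P} {f : ℝ → Matrix V V ℂ}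

namespace IsSpectralDensity

theorem integrable_crossSpec (hf : X.IsSpectralDensity f) (c : V × ℝ →₀ ℂ) (w : V) :
    Integrable fun l => crossSpec f l c w := by
  induction c using Finsupp.induction_linear with
  | zero => simp
  | add c d hc hd => simpa only [map_add] using! hc.add hd
  | single p c =>
    obtain ⟨v, t⟩ := p
    simp only [crossSpec_single]
    refine Integrable.const_mul ?_ c
    refine ((hf.integrable v w).conj_exp_mul (-t)).congr (Eventually.of_forall fun l => ?_)
    simp [← Complex.exp_conj]

theorem inner_toL2_comb (hf : X.IsSpectralDensity f) (w : V) (s : ℝ) (c : V × ℝ →₀ ℂ) :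
    inner ℂ (X.toL2 w s) (X.comb c)
      = ∫ l : ℝ, conj (Complex.exp (Complex.I * l * s)) * crossSpec f l c w := by
  induction c using Finsupp.induction_linear with
  | zero => simp
  | add c d hc hd =>
    simp only [map_add, inner_add_right, hc, hd, Pi.add_apply, mul_add]
    exact (integral_add ((hf.integrable_crossSpec c w).conj_exp_mul s)
      ((hf.integrable_crossSpec d w).conj_exp_mul s)).symm
  | single p c =>
    obtain ⟨v, t⟩ := p
    rw [comb, Finsupp.linearCombination_single, inner_smul_right, hf.inner_toL2,
      ← integral_const_mul]
    refine integral_congr_ae (Eventually.of_forall fun l => ?_)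
    simp only [crossSpec_single]
    ring

theorem integrable_dotProduct_crossSpec (hf : X.IsSpectralDensity f) (c d : V × ℝ →₀ ℂ) :
    Integrable fun l => dotProduct (star (trigVec l c)) (crossSpec f l d) := by
  induction c using Finsupp.induction_linear with
  | zero => simp
  | add c c' hc hc' => simpa only [map_add, star_add, add_dotProduct] using! hc.add hc'
  | single p c =>
    obtain ⟨v, t⟩ := p
    simp only [star_trigVec_single_dotProduct]
    exact ((hf.integrable_crossSpec d v).conj_exp_mul t).const_mul _

theorem inner_comb_comb (hf : X.IsSpectralDensity f) (c d : V × ℝ →₀ ℂ) :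
    inner ℂ (X.comb c) (X.comb d)
      = ∫ l : ℝ, dotProduct (star (trigVec l c)) (crossSpec f l d) := by
  induction c using Finsupp.induction_linear with
  | zero => simp
  | add c c' hc hc' =>
    simp only [map_add, star_add, add_dotProduct, inner_add_left, hc, hc']
    exact (integral_add (hf.integrable_dotProduct_crossSpec c d)
      (hf.integrable_dotProduct_crossSpec c' d)).symm
  | single p c =>
    obtain ⟨v, t⟩ := p
    simp only [star_trigVec_single_dotProduct]
    rw [comb, Finsupp.linearCombination_single, inner_smul_left, ← comb, hf.inner_toL2_comb,
      integral_const_mul]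

theorem norm_comb_sq (hf : X.IsSpectralDensity f) (c : V × ℝ →₀ ℂ) :
    ‖X.comb c‖ ^ 2 = ∫ l : ℝ, (dotProduct (star (trigVec l c)) (crossSpec f l c)).re := by
  rw [← inner_self_eq_norm_sq (𝕜 := ℂ), hf.inner_comb_comb]
  exact (integral_re (hf.integrable_dotProduct_crossSpec c c)).symm

theorem integral_norm_crossSpec_apply_le (hf : X.IsSpectralDensity f)
    (hpos : ∀ l, (f l).PosSemidef) (c : V × ℝ →₀ ℂ) (w : V) :
    ∫ l, ‖crossSpec f l c w‖ ≤ ((∫ l, (f l w w).re) + 1) / 2 * ‖X.comb c‖ := by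
  set K : ℝ := ∫ l, (f l w w).re
  set n : ℝ := ‖X.comb c‖ with hn
  have hfw : Integrable fun l => (f l w w).re := (hf.integrable w w).re
  have key : ∀ r : ℝ, 0 < r → 2 * ∫ l, ‖crossSpec f l c w‖ ≤ r * K + r⁻¹ * n ^ 2 := fun r hr => by
    have hq : Integrable fun l => (dotProduct (star (trigVec l c)) (crossSpec f l c)).re :=
      (hf.integrable_dotProduct_crossSpec c c).re
    rw [hn, hf.norm_comb_sq, ← integral_const_mul, ← integral_const_mul, ← integral_const_mul,
      ← integral_add (hfw.const_mul r) (hq.const_mul r⁻¹)]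
    refine integral_mono ((hf.integrable_crossSpec c w).norm.const_mul 2)
      ((hfw.const_mul r).add (hq.const_mul r⁻¹)) fun l => ?_
    exact (hpos l).transpose.two_mul_norm_mulVec_le (trigVec l c) w hr
  have hn0 : 0 ≤ n := norm_nonneg _
  -- The optimal `r = n` is perturbed to cover the case `n = 0`.
  have hlim : Tendsto (fun η : ℝ => (K + 1) / 2 * (n + η)) (𝓝[>] 0) (𝓝 ((K + 1) / 2 * (n + 0))) :=
    ((by fun_prop : Continuous fun η : ℝ => (K + 1) / 2 * (n + η)).tendsto 0).mono_left
      nhdsWithin_le_nhds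
  rw [add_zero] at hlim
  refine ge_of_tendsto hlim (eventually_mem_nhdsWithin.mono fun η (hη : 0 < η) => ?_)
  have h1 : (n + η)⁻¹ * n ^ 2 ≤ n + η := by
    rw [inv_mul_le_iff₀ (by positivity)]
    nlinarith
  linarith [key (n + η) (by positivity)]

/-- `crossSpec` as a linear map into `L¹(ℝ; ℂ^V)`. -/
noncomputable def crossSpecL1 (hf : X.IsSpectralDensity f) :
    (V × ℝ →₀ ℂ) →ₗ[ℂ] Lp (V → ℂ) 1 (volume : Measure ℝ) where
  toFun c := (Integrable.of_eval (hf.integrable_crossSpec c)).toL1 fun l => crossSpec f l c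
  map_add' c d := by
    rw [← Integrable.toL1_add]
    simp only [map_add]
    rfl
  map_smul' a c := by
    rw [RingHom.id_apply, ← Integrable.toL1_smul]
    simp only [map_smul]

theorem coeFn_crossSpecL1 (hf : X.IsSpectralDensity f) (c : V × ℝ →₀ ℂ) :
    hf.crossSpecL1 c =ᵐ[volume] fun l => crossSpec f l c :=
  Integrable.coeFn_toL1 (Integrable.of_eval (hf.integrable_crossSpec c))

/-- The bound that extends the cross-spectral density from finite linear combinations to their
mean-square limits. -/
theorem exists_norm_crossSpecL1_le (hf : X.IsSpectralDensity f) (hpos : ∀ l, (f l).PosSemidef) :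
    ∃ K : ℝ, ∀ c, ‖hf.crossSpecL1 c‖ ≤ K * ‖X.comb c‖ := by
  refine ⟨∑ w, ((∫ l, (f l w w).re) + 1) / 2, fun c => ?_⟩
  rw [L1.norm_eq_integral_norm, Finset.sum_mul]
  calc ∫ l, ‖hf.crossSpecL1 c l‖ = ∫ l, ‖crossSpec f l c‖ :=
        integral_congr_ae ((hf.coeFn_crossSpecL1 c).fun_comp norm)
    _ ≤ ∫ l, ∑ w, ‖crossSpec f l c w‖ := by
        refine integral_mono (Integrable.of_eval (hf.integrable_crossSpec c)).norm
          (integrable_finsetSum _ fun w _ => (hf.integrable_crossSpec c w).norm) fun l => ?_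
        exact (pi_norm_le_iff_of_nonneg (Finset.sum_nonneg fun _ _ => norm_nonneg _)).2 fun w =>
          Finset.single_le_sum (f := fun w => ‖crossSpec f l c w‖)
            (fun _ _ => norm_nonneg _) (Finset.mem_univ w)
    _ = ∑ w, ∫ l, ‖crossSpec f l c w‖ :=
        integral_finsetSum _ fun w _ => (hf.integrable_crossSpec c w).norm
    _ ≤ _ := Finset.sum_le_sum fun w _ => hf.integral_norm_crossSpec_apply_le hpos c w

end IsSpectralDensity

/-! ### Cross-spectral densities of mean-square limits, and intersections of linear spaces -/

/-- Every `y` in the closed linear span of the subprocess `S` has integrable cross-spectral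
densities `g_w` with the components of the process, and `g(l)` lies, for almost every `l`, in the
image under `f(l)ᵀ` of the vectors supported in `S`. -/
theorem IsSpectralDensity.exists_crossSpec_of_mem_linSpace (hf : X.IsSpectralDensity f)
    (hpos : ∀ l, (f l).PosSemidef) {S : Set V} {y : Lp ℂ 2 P} (hy : y ∈ X.linSpace S) :
    ∃ g : ℝ → V → ℂ, (∀ w, Integrable fun l => g l w) ∧
      (∀ w s, inner ℂ (X.toL2 w s) y
        = ∫ l : ℝ, conj (Complex.exp (Complex.I * l * s)) * g l w) ∧
      ∀ᵐ l, ∃ φ : V → ℂ, (∀ v ∉ S, φ v = 0) ∧ (f l).transpose.mulVec φ = g l := by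
  obtain ⟨c, hc, hcy⟩ := X.exists_seq_comb_tendsto hy
  obtain ⟨K, hK⟩ := hf.exists_norm_crossSpecL1_le hpos
  have hcauchy : CauchySeq fun n => hf.crossSpecL1 (c n) := by
    have hcs := hcy.cauchySeq
    rw [cauchySeq_iff_tendsto_dist_atTop_0] at hcs ⊢
    refine squeeze_zero (fun _ => dist_nonneg) (fun p => ?_) (by simpa using hcs.const_mul K)
    rw [dist_eq_norm, dist_eq_norm, ← map_sub, ← map_sub]
    exact hK _
  obtain ⟨G, hG⟩ := cauchySeq_tendsto_of_complete hcauchy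
  have hGint : ∀ w, Integrable fun l => G l w := fun w => (L1.integrable_coeFn G).eval w
  refine ⟨G, hGint, fun w s => ?_, ?_⟩
  · have h1 : Tendsto (fun n => inner ℂ (X.toL2 w s) (X.comb (c n))) atTop
        (𝓝 (inner ℂ (X.toL2 w s) y)) := tendsto_const_nhds.inner hcy
    refine tendsto_nhds_unique h1 ?_
    rw [tendsto_iff_norm_sub_tendsto_zero] at hG ⊢
    refine squeeze_zero (fun _ => norm_nonneg _) (fun n => ?_) hG
    rw [hf.inner_toL2_comb, ← integral_sub ((hf.integrable_crossSpec _ w).conj_exp_mul s)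
      ((hGint w).conj_exp_mul s), L1.norm_eq_integral_norm]
    refine norm_integral_le_of_norm_le (L1.integrable_coeFn _).norm ?_
    filter_upwards [Lp.coeFn_sub (hf.crossSpecL1 (c n)) G, hf.coeFn_crossSpecL1 (c n)]
      with l hl1 hl2
    rw [hl1, Pi.sub_apply, hl2, ← mul_sub, norm_mul, RCLike.norm_conj, mul_assoc,
      ← Complex.ofReal_mul, Complex.norm_exp_I_mul_ofReal, one_mul]
    exact norm_le_pi_norm (crossSpec f l (c n) - G l) w
  · obtain ⟨ns, -, hns⟩ := (tendstoInMeasure_of_tendsto_Lp hG).exists_seq_tendsto_ae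
    filter_upwards [hns, ae_all_iff.2 fun n => hf.coeFn_crossSpecL1 (c n)] with l hl hcoe
    set W : Submodule ℂ (V → ℂ) :=
      (⨅ v : (Sᶜ : Set V), LinearMap.ker (LinearMap.proj (R := ℂ) (φ := fun _ : V => ℂ) v.1)).map
        (f l).transpose.mulVecLin with hW
    have hWmem : ∀ g, g ∈ W ↔ ∃ φ : V → ℂ, (∀ v ∉ S, φ v = 0) ∧
        (f l).transpose.mulVec φ = g := fun g => by
      simp [hW, Submodule.mem_map, Submodule.mem_iInf, Matrix.mulVec_transpose]
    rw [← hWmem]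
    -- Finite-dimensional subspaces are closed, so the relation passes to the limit.
    refine W.closed_of_finiteDimensional.mem_of_tendsto hl (Eventually.of_forall fun n => ?_)
    rw [hcoe]
    exact (hWmem _).2 ⟨_, fun v hv => trigVec_apply_eq_zero (hc _) hv l, rfl⟩

/-- The only point at which positive definiteness of the spectral density, rather than mere
semidefiniteness, enters. -/
theorem IsSpectralDensity.linSpace_inf (hf : X.IsSpectralDensity f) (hpos : ∀ l, (f l).PosDef)
    (S T : Set V) : X.linSpace S ⊓ X.linSpace T = X.linSpace (S ∩ T) := by
  refine le_antisymm (fun y hy => ?_) (le_inf (X.linSpace_mono Set.inter_subset_left)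
    (X.linSpace_mono Set.inter_subset_right))
  have hps : ∀ l, (f l).PosSemidef := fun l => (hpos l).posSemidef
  set z := y - (X.linSpace (S ∩ T)).starProjection y with hz
  have hpm := Submodule.starProjection_apply_mem (X.linSpace (S ∩ T)) y
  have hzS : z ∈ X.linSpace S :=
    Submodule.sub_mem _ hy.1 (X.linSpace_mono Set.inter_subset_left hpm)
  have hzT : z ∈ X.linSpace T :=
    Submodule.sub_mem _ hy.2 (X.linSpace_mono Set.inter_subset_right hpm)
  have hzorth : z ∈ (X.linSpace (S ∩ T))ᗮ := Submodule.sub_starProjection_mem_orthogonal _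
  -- `z` is the part of `y` orthogonal to the span of `S ∩ T`; it has to vanish.
  suffices hz0 : z = 0 by
    rw [sub_eq_zero.1 (hz.symm.trans hz0)]
    exact hpm
  obtain ⟨g, hgi, hg, hgS⟩ := hf.exists_crossSpec_of_mem_linSpace hps hzS
  obtain ⟨g', hgi', hg', hgT⟩ := hf.exists_crossSpec_of_mem_linSpace hps hzT
  have hgg' : ∀ᵐ l, ∀ w, g l w = g' l w := ae_all_iff.2 fun w => by
    refine (((hgi w).sub (hgi' w)).ae_eq_zero_of_integral_conj_exp_mul_eq_zero fun t => ?_).mono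
      fun l hl => sub_eq_zero.1 hl
    simp only [Pi.sub_apply, mul_sub]
    rw [integral_sub ((hgi w).conj_exp_mul t) ((hgi' w).conj_exp_mul t), ← hg, ← hg', sub_self]
  have hgST : ∀ᵐ l, ∀ w, w ∈ S ∩ T → g l w = 0 := ae_all_iff.2 fun w => by
    by_cases hw : w ∈ S ∩ T
    · refine ((hgi w).ae_eq_zero_of_integral_conj_exp_mul_eq_zero fun t => ?_).mono
        fun l hl _ => hl
      rw [← hg]
      exact hzorth _ (X.toL2_mem_linSpace hw t)
    · exact Eventually.of_forall fun _ h => absurd h hw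
  have hg0 : ∀ᵐ l, g l = 0 := by
    filter_upwards [hgS, hgT, hgg', hgST] with l ⟨φ, hφS, hφ⟩ ⟨φ', hφT, hφ'⟩ hl hlST
    have hpt := (hpos l).transpose
    have hφφ' : φ = φ' := Matrix.mulVec_injective_of_isUnit hpt.isUnit <| by
      rw [hφ, hφ']
      exact funext hl
    by_cases hφ0 : φ = 0
    · rw [← hφ, hφ0, Matrix.mulVec_zero]
    · have hpos' := hpt.dotProduct_mulVec_pos hφ0
      -- In `φ* fᵀ φ = ∑ conj φ_v g_v` each term vanishes: `g_v = 0` on `S ∩ T`, `φ_v = 0` off it.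
      refine absurd ?_ hpos'.ne'
      rw [hφ]
      refine Finset.sum_eq_zero fun v _ => ?_
      by_cases hv : v ∈ S ∩ T
      · rw [hlST v hv, mul_zero]
      · have : φ v = 0 := by
          by_cases hvS : v ∈ S
          · rw [hφφ']
            exact hφT v fun hvT => hv ⟨hvS, hvT⟩
          · exact hφS v hvS
        simp [this]
  have hzS' : z ∈ (X.linSpace S)ᗮ := X.mem_orthogonal_linSpace fun w _ t => by
    rw [hg, ← integral_zero ℝ ℂ]
    refine integral_congr_ae (hg0.mono fun l hl => ?_)
    simp [hl]
  exact inner_self_eq_zero.1 (hzS' z hzS)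

end StationaryProcess

/-! ### The graphoid properties -/

theorem mainTheorem1 {V Ω : Type*} [Fintype V] [MeasurableSpace Ω]
    (P : Measure Ω) [IsProbabilityMeasure P] (X : StationaryProcess V P)
    (f : ℝ → Matrix V V ℂ) (hf : X.IsSpectralDensity f) (hpos : ∀ l : ℝ, (f l).PosDef)
    (A B C D : Set V) (hAB : Disjoint A B) (hAC : Disjoint A C) (hAD : Disjoint A D)
    (hBC : Disjoint B C) (hBD : Disjoint B D) (hCD : Disjoint C D) :
    -- symmetry
    (X.PartiallyUncorrelated A B C → X.PartiallyUncorrelated B A C) ∧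
    -- decomposition
    (X.PartiallyUncorrelated A (B ∪ C) D → X.PartiallyUncorrelated A B D) ∧
    -- weak union
    (X.PartiallyUncorrelated A (B ∪ C) D → X.PartiallyUncorrelated A B (C ∪ D)) ∧
    -- contraction
    (X.PartiallyUncorrelated A B D → X.PartiallyUncorrelated A C (B ∪ D) →
      X.PartiallyUncorrelated A (B ∪ C) D) ∧
    -- intersection
    (X.PartiallyUncorrelated A B (C ∪ D) → X.PartiallyUncorrelated A C (B ∪ D) →
      X.PartiallyUncorrelated A (B ∪ C) D) := by
  classical
  have hCBD : C ∪ (B ∪ D) = B ∪ C ∪ D := by rw [← Set.union_assoc, Set.union_comm C B]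
  refine ⟨X.partiallyUncorrelated_symm, fun h a ha b hb => h a ha b (Or.inl hb), fun h => ?_,
    fun h₁ h₂ => ?_, fun h₁ h₂ => ?_⟩
  · rw [StationaryProcess.partiallyUncorrelated_iff] at h ⊢
    intro a ha s
    rw [← Set.union_assoc]
    exact X.linSpace_mono Set.subset_union_right (h a ha s)
  · rw [StationaryProcess.partiallyUncorrelated_iff] at h₁ h₂ ⊢
    intro a ha s
    have h₃ := h₂ a ha s
    rw [hCBD] at h₃
    have hle : X.linSpace (B ∪ D) ≤ X.linSpace (B ∪ C ∪ D) :=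
      X.linSpace_mono (Set.union_subset_union_left _ Set.subset_union_left)
    have h₄ : (X.linSpace (B ∪ D)).starProjection (X.toL2 a s)
        = (X.linSpace (B ∪ C ∪ D)).starProjection (X.toL2 a s) :=
      Submodule.eq_starProjection_of_mem_orthogonal h₃
        (Submodule.orthogonal_le hle (Submodule.sub_starProjection_mem_orthogonal _))
    rw [← h₄]
    exact h₁ a ha s
  · rw [StationaryProcess.partiallyUncorrelated_iff] at h₁ h₂ ⊢
    intro a ha s
    have h₃ := h₁ a ha s
    have h₄ := h₂ a ha s
    rw [← Set.union_assoc] at h₃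
    rw [hCBD] at h₄
    have h₅ : (C ∪ D) ∩ (B ∪ D) = D := by
      rw [← Set.inter_union_distrib_right, hBC.symm.inter_eq, Set.empty_union]
    rw [← h₅, ← hf.linSpace_inf hpos, h₅]
    exact ⟨h₃, h₄⟩
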